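/- **Proposition (Local Dichotomy of Approximating Sequences).** *Setting.* A mechanism $M$ for bilateral trade consists of an allocation region $A_M\subseteq[0,1]^2$ and payment rules $p,q:[0,1]^2\to[0,1]$, both zero outside $A_M$: at bids $(b_s,b_b)$ trade happens iff $(b_s,b_b)\in A_M$, the seller receives $p(b_s,b_b)$ and the buyer pays $q(b_s,b_b)$. With valuations $v_s,v_b\in[0,1]$ the utilities are $v_s-\mathbf 1\{(b_s,b_b)\in A_M\}v_s+p(b_s,b_b)$ for the seller and $\mathbf 1\{(b_s,b_b)\in A_M\}v_b-q(b_s,b_b)$ for the buyer. Let $\mathcal M^+$ be the class of mechanisms that are dominant-strategy incentive compatible (a truthful bid maximizes each agent's utility whatever the other bids) and individually rational (a truthful bid gives the seller at least $v_s$ and the buyer at least $0$), with $A_M$ closed and $A_M\subseteq\{(x,y)\in[0,1]^2: x\le y\}$. Put $\mathsf{profit}(M,v)=q(v)-p(v)$. *Approximating sequence.* Let $\partial M$ be the set of points of $A_M$ every neighbourhood of which meets $[0,1]^2\setminus A_M$; it is totally ordered by the coordinatewise order. For $\varepsilon>0$ let $G_\varepsilon\subseteq[0,1]^2$ be the union of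 the horizontal and vertical segments across the square at the coordinates $0$, $1$ and $i\varepsilon$, $1\le i\le\lfloor 1/\varepsilon\rfloor$. Consider the points of $\partial M\cap G_\varepsilon$, where of a (horizontal or vertical) segment shared by $\partial M$ and $G_\varepsilon$ only the first and the last point are kept. Let $\pi_M^\varepsilon$ be the path through all these points in which consecutive points $v=(v_1,v_2)$, $v'=(v_1',v_2')$ are joined by the segment from $v$ to $(v_1',v_2)$ followed by the segment from $(v_1',v_2)$ to $v'$ (thus by a straight segment if they share a coordinate). The simplified mechanism $M_\varepsilon$ has the allocation region $A=\{(x,y)\in[0,1]^2:\exists\,(w_1,w_2)\in\pi_M^\varepsilon,\ x\le w_1,\ y\ge w_2\}$ and the Myerson payments $p(b_s,b_b)=\max\{x:(x,b_b)\in A\}$, $q(b_s,b_b)=\min\{y:(b_s,y)\in A\}$ for $(b_s,b_b)\in A$, and $p=q=0$ elsewhere. For $h\in\mathbb N=\{0,1,2,\dots\}$ let $\phi_h(M)=M_{2^{-h}}$. *Claim.* Let $M\in\mathcal M^+$, let $h\in\mathbb N$, and let $V$ be distributed according to any Borel probability measure on $[0,1]^2$. Then $\mathsf{profit}(\phi_h(M),V)$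 and $\mathsf{profit}(\phi_{h+1}(M),V)$ are integrable, the square of their difference is integrable, and at least one of the following holds: 1. $\mathbb E\big[\mathsf{profit}(\phi_h(M),V)-\mathsf{profit}(\phi_{h+1}(M),V)\big]\ge 31\cdot 2^{-h}$; 2. $\mathbb E\big[(\mathsf{profit}(\phi_{h+1}(M),V)-\mathsf{profit}(\phi_h(M),V))^2\big]\le 136\cdot 2^{-h}$. -/

import Mathlib

open MeasureTheory unitInterval

/-- The square `[0,1]²` of valuation or bid pairs: first coordinate seller, second coordinate buyer.
It carries the product (coordinatewise) order, topology and Borel structure. -/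
abbrev UnitSquare : Type := I × I

/-- A mechanism for bilateral trade: an allocation region and two pricing rules with values in
`[0,1]` (`sellerPay` is paid to the seller, `buyerPay` is paid by the buyer); without trade both
payments are zero. -/
structure Mechanism where
  alloc : Set UnitSquare
  sellerPay : UnitSquare → I
  buyerPay : UnitSquare → I
  sellerPay_eq_zero : ∀ b, b ∉ alloc → sellerPay b = 0
  buyerPay_eq_zero : ∀ b, b ∉ alloc → buyerPay b = 0

namespace Mechanism

/-- The indicator of trade. -/
noncomputable def trade (M : Mechanism) (b : UnitSquare) : ℝ :=
  M.alloc.indicator (fun _ => (1 : ℝ)) b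

/-- Utility of a seller with valuation `vs` under the bids `b`. -/
noncomputable def sellerUtility (M : Mechanism) (vs : I) (b : UnitSquare) : ℝ :=
  (vs : ℝ) - M.trade b * (vs : ℝ) + (M.sellerPay b : ℝ)

/-- Utility of a buyer with valuation `vb` under the bids `b`. -/
noncomputable def buyerUtility (M : Mechanism) (vb : I) (b : UnitSquare) : ℝ :=
  M.trade b * (vb : ℝ) - (M.buyerPay b : ℝ)

/-- Dominant-strategy incentive compatibility: truthful bids are optimal whatever the other bid. -/
def IsDSIC (M : Mechanism) : Prop :=
  (∀ vs bs bb : I, M.sellerUtility vs (bs, bb) ≤ M.sellerUtility vs (vs, bb)) ∧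
  (∀ vb bs bb : I, M.buyerUtility vb (bs, bb) ≤ M.buyerUtility vb (bs, vb))

/-- Individual rationality. -/
def IsIR (M : Mechanism) : Prop :=
  (∀ vs bb : I, (vs : ℝ) ≤ M.sellerUtility vs (vs, bb)) ∧
  (∀ vb bs : I, 0 ≤ M.buyerUtility vb (bs, vb))

/-- The broker's profit at truthful bids. -/
def profit (M : Mechanism) (v : UnitSquare) : ℝ :=
  (M.buyerPay v : ℝ) - (M.sellerPay v : ℝ)

/-- The class of DSIC and IR mechanisms; allocation regions are taken to be closed. -/
def classM : Set Mechanism :=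
  {M | M.IsDSIC ∧ M.IsIR ∧ IsClosed M.alloc}

/-- The upper-left triangle. -/
def upperTriangle : Set UnitSquare := {v | v.1 ≤ v.2}

/-- The mechanisms of `classM` whose allocation region lies in the upper-left triangle. -/
def classMPlus : Set Mechanism :=
  {M | M ∈ classM ∧ M.alloc ⊆ upperTriangle}

/-- `Dominated x y`: the point `y` dominates `x`, i.e. `y` lies north-west of `x`. -/
def Dominated (x y : UnitSquare) : Prop := y.1 ≤ x.1 ∧ x.2 ≤ y.2

/-- The mechanism with allocation region `A` and the Myerson payments
`max {x | (x, b_b) ∈ A}` to the seller and `min {y | (b_s, y) ∈ A}` by the buyer in case of trade.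
(The maximum and minimum are attained when `A` is closed, see the two lemmas below.) -/
noncomputable def myerson (A : Set UnitSquare) : Mechanism where
  alloc := A
  sellerPay := A.indicator fun b => sSup {x : I | (x, b.2) ∈ A}
  buyerPay := A.indicator fun b => sInf {y : I | (b.1, y) ∈ A}
  sellerPay_eq_zero := fun _ hb => Set.indicator_of_notMem hb _
  buyerPay_eq_zero := fun _ hb => Set.indicator_of_notMem hb _

theorem myerson_sellerPay_isGreatest {A : Set UnitSquare} (hA : IsClosed A) {b : UnitSquare}
    (hb : b ∈ A) : IsGreatest {x : I | (x, b.2) ∈ A} ((myerson A).sellerPay b) := by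
  have hc : IsClosed {x : I | (x, b.2) ∈ A} := hA.preimage (by fun_prop)
  have h := hc.isCompact.isGreatest_sSup ⟨b.1, hb⟩
  simpa only [myerson, Set.indicator_of_mem hb] using h

theorem myerson_buyerPay_isLeast {A : Set UnitSquare} (hA : IsClosed A) {b : UnitSquare}
    (hb : b ∈ A) : IsLeast {y : I | (b.1, y) ∈ A} ((myerson A).buyerPay b) := by
  have hc : IsClosed {y : I | (b.1, y) ∈ A} := hA.preimage (by fun_prop)
  have h := hc.isCompact.isLeast_sInf ⟨b.2, hb⟩
  simpa only [myerson, Set.indicator_of_mem hb] using h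

/-- The boundary of a mechanism: the points of the allocation region every ball around which
(in the square) contains points without trade. -/
def boundary (M : Mechanism) : Set UnitSquare :=
  {v | v ∈ M.alloc ∧ ∀ r > (0 : ℝ), (M.allocᶜ ∩ Metric.ball v r).Nonempty}

/-- The coordinates of the lines of the uniform grid with step `ε`:
`0`, `1` and `i ε` for `i = 1, …, ⌊1/ε⌋`. -/
def gridCoords (ε : ℝ) : Set I :=
  {x | x = 0 ∨ x = 1 ∨ ∃ i : ℕ, 1 ≤ i ∧ i ≤ ⌊1 / ε⌋₊ ∧ (x : ℝ) = i * ε}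

/-- The uniform grid with step `ε`, as the union of its horizontal and vertical edges. -/
def grid (ε : ℝ) : Set UnitSquare :=
  {v | v.1 ∈ gridCoords ε ∨ v.2 ∈ gridCoords ε}

/-- The intersection points of the boundary and the grid. If the boundary and the grid share an
axis-parallel segment, only its first and last point are kept, so the points in the relative
interior of such a segment are left out. An axis-parallel segment from `a` to `b`, directed
rightwards or upwards, is the order interval `Set.Icc a b` where `a ≤ b` agree in a coordinate. -/
def crossings (M : Mechanism) (ε : ℝ) : Set UnitSquare :=
  {v | v ∈ M.boundary ∩ grid ε ∧
    ¬ ∃ a b : UnitSquare, a < v ∧ v < b ∧ (a.1 = b.1 ∨ a.2 = b.2) ∧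
      Set.Icc a b ⊆ M.boundary ∩ grid ε}

/-- `v` comes directly before `v'` among the intersection points, ordered along the boundary,
i.e. coordinatewise. -/
def Consecutive (M : Mechanism) (ε : ℝ) (v v' : UnitSquare) : Prop :=
  v ∈ M.crossings ε ∧ v' ∈ M.crossings ε ∧ v < v' ∧
    ¬ ∃ w ∈ M.crossings ε, v < w ∧ w < v'

/-- The connection of two consecutive points `v ≤ v'`: rightwards from `v` to the corner
`(v'.1, v.2)`, then upwards to `v'`. If `v` and `v'` agree in a coordinate, then the corner is `v`
or `v'`, and this is the straight segment from `v` to `v'`. -/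
def connection (v v' : UnitSquare) : Set UnitSquare :=
  Set.Icc v (v'.1, v.2) ∪ Set.Icc (v'.1, v.2) v'

/-- The complete path through all the intersection points, consecutive ones being connected by
`connection`. -/
def path (M : Mechanism) (ε : ℝ) : Set UnitSquare :=
  M.crossings ε ∪ {w | ∃ v v' : UnitSquare, M.Consecutive ε v v' ∧ w ∈ connection v v'}

/-- The allocation region of a path: all points that dominate a point of the path. -/
def pathRegion (π : Set UnitSquare) : Set UnitSquare :=
  {v | ∃ w ∈ π, Dominated w v}

/-- The simplified mechanism with precision `ε`: the mechanism induced by the path. -/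
noncomputable def simplified (M : Mechanism) (ε : ℝ) : Mechanism :=
  myerson (pathRegion (M.path ε))

/-- The approximating sequence `φ_h(M)`: the simplified mechanisms with precisions `2⁻ʰ`. -/
noncomputable def approx (h : ℕ) (M : Mechanism) : Mechanism :=
  M.simplified ((2 : ℝ) ^ (-(h : ℤ)))

end Mechanism

/-! Everything follows from one pointwise bound: refining the grid from step `ε` raises the profit
nowhere by more than `2 * ε` (`profit_simplified_le`). So `X`, the profit at level `h` minus that at
level `h + 1`, lies in `[-2ε, 2]`, whence `X² ≤ 2X + 8ε`. If `E[X] < 31ε`, then `E[X²] ≤ 70ε`, well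
within the claimed constant. The bound rests on `mem_pathRegion_iff`: within the coordinate range of
trade, the simplified region consists of the points not strictly south-east of any crossing,
equivalently of any boundary point on the grid. Hence the region contains `M.alloc`, shrinks under
refinement, and exceeds `M.alloc` by at most `ε` horizontally and vertically, since a grid line lies
that close. Both simplified prices are then compared through trades of `M` itself. -/

namespace Mechanism

/-! ### Monotonicity of the allocation region -/

variable {M : Mechanism}

/-- If `x'` did not trade, bidding `x` instead would earn the payment, which is at least `x > x'` by
individual rationality at `x`. -/
theorem seller_mem_alloc (h1 : M.IsDSIC) (h2 : M.IsIR) {x x' y : I} (hx : x' ≤ x)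
    (h : (x, y) ∈ M.alloc) : (x', y) ∈ M.alloc := by
  by_contra hn
  have hne : x' ≠ x := fun e => hn (e ▸ h)
  have hlt : (x' : ℝ) < x := Subtype.coe_lt_coe.mpr (lt_of_le_of_ne hx hne)
  have a := h1.1 x' x y
  have b := h2.1 x y
  simp only [sellerUtility, trade, Set.indicator_of_mem h, Set.indicator_of_notMem hn,
    M.sellerPay_eq_zero _ hn, Set.Icc.coe_zero] at a b
  linarith

theorem buyer_mem_alloc (h1 : M.IsDSIC) (h2 : M.IsIR) {x y y' : I} (hy : y ≤ y')
    (h : (x, y) ∈ M.alloc) : (x, y') ∈ M.alloc := by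
  by_contra hn
  have hne : y ≠ y' := fun e => hn (e ▸ h)
  have hlt : (y : ℝ) < y' := Subtype.coe_lt_coe.mpr (lt_of_le_of_ne hy hne)
  have a := h1.2 y' x y
  have b := h2.2 y x
  simp only [buyerUtility, trade, Set.indicator_of_mem h, Set.indicator_of_notMem hn,
    M.buyerPay_eq_zero _ hn, Set.Icc.coe_zero] at a b
  linarith

/-- Allocation regions of DSIC and IR mechanisms are closed under passing to dominating points. -/
theorem mem_alloc_of_dominated (hM : M ∈ classMPlus) {w v : UnitSquare} (hw : w ∈ M.alloc)
    (h : Dominated w v) : v ∈ M.alloc :=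
  buyer_mem_alloc hM.1.1 hM.1.2.1 h.2 (seller_mem_alloc hM.1.1 hM.1.2.1 h.1 hw)

theorem le_of_mem_alloc (hM : M ∈ classMPlus) {w : UnitSquare} (hw : w ∈ M.alloc) : w.1 ≤ w.2 :=
  hM.2 hw

theorem isClosed_alloc (hM : M ∈ classMPlus) : IsClosed M.alloc := hM.1.2.2

/-! ### The boundary as a closed monotone chain -/

/-- A point of the boundary lies strictly south-east of no other point with trade. -/
theorem not_lt_of_mem_boundary (hM : M ∈ classMPlus) {w z : UnitSquare} (hw : w ∈ M.boundary)
    (hz : z ∈ M.alloc) (h1 : w.1 < z.1) : w.2 ≤ z.2 := by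
  by_contra! h2
  have ho : IsOpen {v : UnitSquare | v.1 < z.1 ∧ z.2 < v.2} :=
    (isOpen_lt (by fun_prop) (by fun_prop)).inter (isOpen_lt (by fun_prop) (by fun_prop))
  obtain ⟨r, hr, hs⟩ := Metric.isOpen_iff.mp ho w ⟨h1, h2⟩
  obtain ⟨v, hv, hvr⟩ := hw.2 r hr
  have := hs hvr
  exact hv (mem_alloc_of_dominated hM hz ⟨this.1.le, this.2.le⟩)

theorem mem_boundary_of_mem_closure {w : UnitSquare} (hw : w ∈ M.alloc)
    (h : w ∈ closure M.allocᶜ) : w ∈ M.boundary := by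
  refine ⟨hw, fun r hr => ?_⟩
  obtain ⟨b, hb, hd⟩ := Metric.mem_closure_iff.mp h r hr
  exact ⟨b, hb, by rwa [Metric.mem_ball, dist_comm]⟩

/-- A point with trade lies on the boundary if no point with trade lies strictly south-east. -/
theorem mem_boundary (hM : M ∈ classMPlus) {w : UnitSquare} (hw : w ∈ M.alloc)
    (h : ∀ z ∈ M.alloc, w.1 < z.1 → w.2 ≤ z.2) : w ∈ M.boundary := by
  apply mem_boundary_of_mem_closure hw
  obtain ⟨a, b⟩ := w
  have hab : a ≤ b := le_of_mem_alloc hM hw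
  -- At the edge `a = 1` the square has no points further right, but the triangle forces `b = 1` and
  -- excludes trade directly below. The case `b = 0` is symmetric.
  rcases eq_or_ne a 1 with rfl | ha
  · have hb : b = 1 := le_antisymm le_top hab
    subst hb
    have hcl : (1 : I) ∈ closure (Set.Iio 1) := by
      rw [closure_Iio' ⟨0, zero_lt_one⟩]; exact Set.self_mem_Iic
    have : ((1 : I), (1 : I)) ∈ closure ({1} ×ˢ Set.Iio 1) := by
      rw [closure_prod_eq]; exact ⟨subset_closure rfl, hcl⟩
    refine closure_mono ?_ this
    rintro ⟨x, y⟩ ⟨rfl, hy⟩ hm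
    exact absurd (le_of_mem_alloc hM hm) (not_le.mpr hy)
  rcases eq_or_ne b 0 with rfl | hb
  · have ha0 : a = 0 := le_antisymm hab bot_le
    subst ha0
    have hcl : (0 : I) ∈ closure (Set.Ioi 0) := by
      rw [closure_Ioi' ⟨1, zero_lt_one⟩]; exact Set.self_mem_Ici
    have : ((0 : I), (0 : I)) ∈ closure (Set.Ioi 0 ×ˢ {0}) := by
      rw [closure_prod_eq]; exact ⟨hcl, subset_closure rfl⟩
    refine closure_mono ?_ this
    rintro ⟨x, y⟩ ⟨hx, rfl⟩ hm
    exact absurd (le_of_mem_alloc hM hm) (not_le.mpr hx)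
  · have h1 : a ∈ closure (Set.Ioi a) := by
      rw [closure_Ioi' ⟨1, lt_of_le_of_ne le_top ha⟩]; exact Set.self_mem_Ici
    have h2 : b ∈ closure (Set.Iio b) := by
      rw [closure_Iio' ⟨0, lt_of_le_of_ne bot_le hb.symm⟩]; exact Set.self_mem_Iic
    have : (a, b) ∈ closure (Set.Ioi a ×ˢ Set.Iio b) := by
      rw [closure_prod_eq]; exact ⟨h1, h2⟩
    refine closure_mono ?_ this
    rintro ⟨x, y⟩ ⟨hx, hy⟩ hm
    exact absurd (h _ hm hx) (not_le.mpr hy)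

theorem isClosed_boundary (hM : M ∈ classMPlus) : IsClosed M.boundary := by
  have : M.boundary = M.alloc ∩ closure M.allocᶜ := by
    ext w
    refine ⟨fun h => ⟨h.1, ?_⟩, fun h => mem_boundary_of_mem_closure h.1 h.2⟩
    refine Metric.mem_closure_iff.mpr fun r hr => ?_
    obtain ⟨b, hb, hd⟩ := h.2 r hr
    exact ⟨b, hb, by rwa [Metric.mem_ball, dist_comm] at hd⟩
  rw [this]
  exact (isClosed_alloc hM).inter isClosed_closure

theorem boundary_total (hM : M ∈ classMPlus) {v w : UnitSquare} (hv : v ∈ M.boundary)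
    (hw : w ∈ M.boundary) : v ≤ w ∨ w ≤ v := by
  rcases lt_trichotomy v.1 w.1 with h | h | h
  · exact Or.inl ⟨h.le, not_lt_of_mem_boundary hM hv hw.1 h⟩
  · exact (le_total v.2 w.2).imp (fun h2 => ⟨h.le, h2⟩) (fun h2 => ⟨h.ge, h2⟩)
  · exact Or.inr ⟨h.le, not_lt_of_mem_boundary hM hw hv.1 h⟩

/-- One endpoint excludes trade strictly south-east of the whole segment: the upper one if it is
vertical, the left one if it is horizontal. -/
theorem Icc_subset_boundary (hM : M ∈ classMPlus) {v w : UnitSquare} (hv : v ∈ M.boundary)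
    (hw : w ∈ M.boundary) (h : v.1 = w.1 ∨ v.2 = w.2) : Set.Icc v w ⊆ M.boundary := by
  rintro t ⟨h1, h2⟩
  rcases h with h | h
  · have e : t.1 = v.1 := le_antisymm (h2.1.trans h.ge) h1.1
    refine mem_boundary hM (mem_alloc_of_dominated hM hv.1 ⟨e.le, h1.2⟩) fun z hz hlt => ?_
    exact h2.2.trans (not_lt_of_mem_boundary hM hw hz (by rwa [← h, ← e]))
  · have e : t.2 = w.2 := le_antisymm h2.2 (h.ge.trans h1.2)
    refine mem_boundary hM (mem_alloc_of_dominated hM hw.1 ⟨h2.1, e.ge⟩) fun z hz hlt => ?_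
    exact (e.trans h.symm).le.trans (not_lt_of_mem_boundary hM hv hz (h1.1.trans_lt hlt))

/-- The lowest point with trade above a given seller valuation is on the boundary. -/
theorem exists_boundary_vertical (hM : M ∈ classMPlus) {x y : I} (h : (x, y) ∈ M.alloc) :
    ∃ y', y' ≤ y ∧ (x, y') ∈ M.boundary ∧ ∀ t, (x, t) ∈ M.alloc → y' ≤ t := by
  have hc : IsClosed {y : I | (x, y) ∈ M.alloc} := (isClosed_alloc hM).preimage (by fun_prop)
  obtain ⟨y', hy', hl⟩ := hc.isCompact.exists_isLeast ⟨y, h⟩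
  refine ⟨y', hl h, mem_boundary hM hy' fun z hz hlt => ?_, fun t ht => hl ht⟩
  exact hl (mem_alloc_of_dominated hM hz ⟨hlt.le, le_rfl⟩)

theorem exists_boundary_horizontal (hM : M ∈ classMPlus) {x y : I} (h : (x, y) ∈ M.alloc) :
    ∃ x', x ≤ x' ∧ (x', y) ∈ M.boundary ∧ ∀ t, (t, y) ∈ M.alloc → t ≤ x' := by
  have hc : IsClosed {x : I | (x, y) ∈ M.alloc} := (isClosed_alloc hM).preimage (by fun_prop)
  obtain ⟨x', hx', hl⟩ := hc.isCompact.exists_isGreatest ⟨x, h⟩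
  refine ⟨x', hl h, mem_boundary hM hx' fun z hz hlt => ?_, fun t ht => hl ht⟩
  by_contra! hz2
  exact absurd (hl (mem_alloc_of_dominated hM hz ⟨le_rfl, hz2.le⟩)) (not_le.mpr hlt)

/-! ### Crossings of the boundary with the grid -/

theorem finite_gridCoords (ε : ℝ) : (gridCoords ε).Finite := by
  have hf : (((fun i : ℕ => (i : ℝ) * ε) '' Set.Iic ⌊1 / ε⌋₊) ∪ {0, 1}).Finite :=
    ((Set.finite_Iic _).image _).union (Set.toFinite _)
  refine (hf.preimage (f := ((↑) : I → ℝ)) Subtype.val_injective.injOn).subset ?_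
  rintro x (rfl | rfl | ⟨i, -, hi, hx⟩)
  · right; simp
  · right; simp
  · left; exact ⟨i, hi, hx.symm⟩

/-- Otherwise infinitely many heights would all be grid coordinates. -/
theorem fst_mem_gridCoords {ε : ℝ} {a b : UnitSquare} (hab : a < b) (h : a.1 = b.1)
    (hs : Set.Icc a b ⊆ grid ε) : a.1 ∈ gridCoords ε := by
  by_contra hn
  have hlt : a.2 < b.2 := (Prod.lt_iff.mp hab).elim (fun k => absurd h k.1.ne) (fun k => k.2)
  refine Set.Icc_infinite hlt ((finite_gridCoords ε).subset fun t ht => ?_)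
  exact (@hs (a.1, t) ⟨⟨le_rfl, ht.1⟩, ⟨h.le, ht.2⟩⟩).resolve_left hn

theorem snd_mem_gridCoords {ε : ℝ} {a b : UnitSquare} (hab : a < b) (h : a.2 = b.2)
    (hs : Set.Icc a b ⊆ grid ε) : a.2 ∈ gridCoords ε := by
  by_contra hn
  have hlt : a.1 < b.1 := (Prod.lt_iff.mp hab).elim (fun k => k.1) (fun k => absurd h k.2.ne)
  refine Set.Icc_infinite hlt ((finite_gridCoords ε).subset fun t ht => ?_)
  exact (@hs (t, a.2) ⟨⟨ht.1, le_rfl⟩, ⟨ht.2, h.le⟩⟩).resolve_right hn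

/-- The witnesses are the extreme boundary points on the vertical line. A vertical shared segment
through one of them would contradict extremality; a horizontal one would place two boundary points
strictly north-west and south-east of each other. -/
theorem exists_crossings_vertical (hM : M ∈ classMPlus) {ε : ℝ} {a₀ v b₀ : UnitSquare}
    (hav : a₀ < v) (hvb : v < b₀) (h : a₀.1 = b₀.1)
    (hs : Set.Icc a₀ b₀ ⊆ M.boundary ∩ grid ε) :
    ∃ a ∈ M.crossings ε, ∃ b ∈ M.crossings ε, a ≤ v ∧ v ≤ b ∧ a.1 = v.1 ∧ b.1 = v.1 := by
  have hab := hav.trans hvb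
  have hc := fst_mem_gridCoords hab h (fun t ht => (hs ht).2)
  have ha₀ : a₀ ∈ M.boundary := (hs ⟨le_rfl, hab.le⟩).1
  have hb₀ : b₀ ∈ M.boundary := (hs ⟨hab.le, le_rfl⟩).1
  have hv1 : v.1 = a₀.1 := le_antisymm (hvb.le.1.trans h.ge) hav.le.1
  have hlt : a₀.2 < b₀.2 := (Prod.lt_iff.mp hab).elim (fun k => absurd h k.1.ne) (fun k => k.2)
  have hK : IsCompact {y : I | (a₀.1, y) ∈ M.boundary} :=
    ((isClosed_boundary hM).preimage (by fun_prop)).isCompact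
  obtain ⟨s, hsK, hsl⟩ := hK.exists_isLeast ⟨a₀.2, ha₀⟩
  obtain ⟨t, htK, htg⟩ := hK.exists_isGreatest ⟨a₀.2, ha₀⟩
  have hsa : s ≤ a₀.2 := hsl ha₀
  have hbt : b₀.2 ≤ t := htg (by rw [h]; exact hb₀)
  refine ⟨(a₀.1, s), ⟨⟨hsK, Or.inl hc⟩, ?_⟩, (a₀.1, t), ⟨⟨htK, Or.inl hc⟩, ?_⟩,
    ⟨hv1.ge, hsa.trans hav.le.2⟩, ⟨hv1.le, hvb.le.2.trans hbt⟩, hv1.symm, hv1.symm⟩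
  · rintro ⟨α, β, h1, h2, h3 | h3, hsub⟩
    · have e : α.1 = a₀.1 := le_antisymm h1.le.1 (h3.ge.trans' h2.le.1)
      have hα : (a₀.1, α.2) ∈ M.boundary := by
        rw [← e]; exact (hsub ⟨le_rfl, (h1.trans h2).le⟩).1
      exact absurd (Prod.ext e (le_antisymm h1.le.2 (hsl hα)) : α = (a₀.1, s)) h1.ne
    · have e : β.2 = s := le_antisymm (h3.ge.trans h1.le.2) h2.le.2
      have hβ : β ∈ M.alloc := (hsub ⟨(h1.trans h2).le, le_rfl⟩).1.1
      have hl : a₀.1 < β.1 := lt_of_le_of_ne h2.le.1 fun k => h2.ne (Prod.ext k e.symm)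
      have := not_lt_of_mem_boundary hM hb₀ hβ (h ▸ hl)
      exact absurd (this.trans (e.le.trans hsa)) (not_le.mpr hlt)
  · rintro ⟨α, β, h1, h2, h3 | h3, hsub⟩
    · have e : β.1 = a₀.1 := le_antisymm (h3.ge.trans h1.le.1) h2.le.1
      have hβ : (a₀.1, β.2) ∈ M.boundary := by
        rw [← e]; exact (hsub ⟨(h1.trans h2).le, le_rfl⟩).1
      exact absurd (Prod.ext e (le_antisymm (htg hβ) h2.le.2) : β = (a₀.1, t)) h2.ne'
    · have e : α.2 = t := le_antisymm h1.le.2 (h3.ge.trans' h2.le.2)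
      have hα : α ∈ M.boundary := (hsub ⟨le_rfl, (h1.trans h2).le⟩).1
      have hl : α.1 < a₀.1 := lt_of_le_of_ne h1.le.1 fun k => h1.ne (Prod.ext k e)
      have := not_lt_of_mem_boundary hM hα ha₀.1 hl
      exact absurd ((hbt.trans e.ge).trans this) (not_le.mpr hlt)

theorem exists_crossings_horizontal (hM : M ∈ classMPlus) {ε : ℝ} {a₀ v b₀ : UnitSquare}
    (hav : a₀ < v) (hvb : v < b₀) (h : a₀.2 = b₀.2)
    (hs : Set.Icc a₀ b₀ ⊆ M.boundary ∩ grid ε) :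
    ∃ a ∈ M.crossings ε, ∃ b ∈ M.crossings ε, a ≤ v ∧ v ≤ b ∧ a.2 = v.2 ∧ b.2 = v.2 := by
  have hab := hav.trans hvb
  have hc := snd_mem_gridCoords hab h (fun t ht => (hs ht).2)
  have ha₀ : a₀ ∈ M.boundary := (hs ⟨le_rfl, hab.le⟩).1
  have hb₀ : b₀ ∈ M.boundary := (hs ⟨hab.le, le_rfl⟩).1
  have hv1 : v.2 = a₀.2 := le_antisymm (hvb.le.2.trans h.ge) hav.le.2
  have hlt : a₀.1 < b₀.1 := (Prod.lt_iff.mp hab).elim (fun k => k.1) (fun k => absurd h k.2.ne)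
  have hK : IsCompact {x : I | (x, a₀.2) ∈ M.boundary} :=
    ((isClosed_boundary hM).preimage (by fun_prop)).isCompact
  obtain ⟨s, hsK, hsl⟩ := hK.exists_isLeast ⟨a₀.1, ha₀⟩
  obtain ⟨t, htK, htg⟩ := hK.exists_isGreatest ⟨a₀.1, ha₀⟩
  have hsa : s ≤ a₀.1 := hsl ha₀
  have hbt : b₀.1 ≤ t := htg (by rw [h]; exact hb₀)
  refine ⟨(s, a₀.2), ⟨⟨hsK, Or.inr hc⟩, ?_⟩, (t, a₀.2), ⟨⟨htK, Or.inr hc⟩, ?_⟩,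
    ⟨hsa.trans hav.le.1, hv1.ge⟩, ⟨hvb.le.1.trans hbt, hv1.le⟩, hv1.symm, hv1.symm⟩
  · rintro ⟨α, β, h1, h2, h3 | h3, hsub⟩
    · have e : β.1 = s := le_antisymm (h3.ge.trans h1.le.1) h2.le.1
      have hβ : β ∈ M.boundary := (hsub ⟨(h1.trans h2).le, le_rfl⟩).1
      have hl : a₀.2 < β.2 := lt_of_le_of_ne h2.le.2 fun k => h2.ne (Prod.ext e.symm k)
      have := not_lt_of_mem_boundary hM hβ hb₀.1 ((e.le.trans hsa).trans_lt hlt)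
      exact absurd (this.trans h.ge) (not_le.mpr hl)
    · have e : α.2 = a₀.2 := le_antisymm h1.le.2 (h3.ge.trans' h2.le.2)
      have hα : (α.1, a₀.2) ∈ M.boundary := by
        rw [← e]; exact (hsub ⟨le_rfl, (h1.trans h2).le⟩).1
      exact absurd (Prod.ext (le_antisymm h1.le.1 (hsl hα)) e : α = (s, a₀.2)) h1.ne
  · rintro ⟨α, β, h1, h2, h3 | h3, hsub⟩
    · have e : α.1 = t := le_antisymm h1.le.1 (h3.ge.trans' h2.le.1)
      have hα : α ∈ M.alloc := (hsub ⟨le_rfl, (h1.trans h2).le⟩).1.1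
      have hl : α.2 < a₀.2 := lt_of_le_of_ne h1.le.2 fun k => h1.ne (Prod.ext e k)
      have := not_lt_of_mem_boundary hM ha₀ hα (hlt.trans_le (hbt.trans e.ge))
      exact absurd this (not_le.mpr hl)
    · have e : β.2 = a₀.2 := le_antisymm (h3.ge.trans h1.le.2) h2.le.2
      have hβ : (β.1, a₀.2) ∈ M.boundary := by
        rw [← e]; exact (hsub ⟨(h1.trans h2).le, le_rfl⟩).1
      exact absurd (Prod.ext (le_antisymm (htg hβ) h2.le.1) e : β = (t, a₀.2)) h2.ne'

/-- Every common point of boundary and grid lies on an axis-parallel segment between two kept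
intersection points. -/
theorem exists_crossings (hM : M ∈ classMPlus) {ε : ℝ} {v : UnitSquare}
    (hv : v ∈ M.boundary ∩ grid ε) :
    ∃ a ∈ M.crossings ε, ∃ b ∈ M.crossings ε, a ≤ v ∧ v ≤ b ∧
      (a.1 = v.1 ∧ b.1 = v.1 ∨ a.2 = v.2 ∧ b.2 = v.2) := by
  by_cases hcr : v ∈ M.crossings ε
  · exact ⟨v, hcr, v, hcr, le_rfl, le_rfl, Or.inl ⟨rfl, rfl⟩⟩
  · obtain ⟨a₀, b₀, h1, h2, h3 | h3, hs⟩ : ∃ a b : UnitSquare, a < v ∧ v < b ∧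
        (a.1 = b.1 ∨ a.2 = b.2) ∧ Set.Icc a b ⊆ M.boundary ∩ grid ε := by
      by_contra hn; exact hcr ⟨hv, hn⟩
    · obtain ⟨a, ha, b, hb, h4, h5, h6⟩ := exists_crossings_vertical hM h1 h2 h3 hs
      exact ⟨a, ha, b, hb, h4, h5, Or.inl h6⟩
    · obtain ⟨a, ha, b, hb, h4, h5, h6⟩ := exists_crossings_horizontal hM h1 h2 h3 hs
      exact ⟨a, ha, b, hb, h4, h5, Or.inr h6⟩

/-- A chain without three distinct elements is finite. -/
theorem finite_of_forall_not_lt_lt {α : Type*} [PartialOrder α] {S : Set α}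
    (htot : ∀ a ∈ S, ∀ b ∈ S, a ≤ b ∨ b ≤ a)
    (h : ∀ a ∈ S, ∀ b ∈ S, ∀ c ∈ S, a < b → ¬ b < c) : S.Finite := by
  by_cases hlt : ∃ a ∈ S, ∃ b ∈ S, a < b
  · obtain ⟨a, ha, b, hb, hab⟩ := hlt
    refine (Set.toFinite {a, b}).subset fun x hx => ?_
    by_contra hn
    simp only [Set.mem_insert_iff, Set.mem_singleton_iff, not_or] at hn
    rcases htot x hx b hb with h1 | h1
    · rcases htot a ha x hx with h2 | h2
      · exact h a ha x hx b hb (lt_of_le_of_ne h2 (Ne.symm hn.1)) (lt_of_le_of_ne h1 hn.2)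
      · exact h x hx a ha b hb (lt_of_le_of_ne h2 hn.1) hab
    · exact h a ha b hb x hx hab (lt_of_le_of_ne h1 (Ne.symm hn.2))
  · push Not at hlt
    refine Set.Subsingleton.finite fun a ha b hb => ?_
    by_contra hne
    rcases htot a ha b hb with h1 | h1
    · exact hlt a ha b hb (lt_of_le_of_ne h1 hne)
    · exact hlt b hb a ha (lt_of_le_of_ne h1 (Ne.symm hne))

theorem crossings_total (hM : M ∈ classMPlus) {ε : ℝ} {v w : UnitSquare}
    (hv : v ∈ M.crossings ε) (hw : w ∈ M.crossings ε) : v ≤ w ∨ w ≤ v :=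
  boundary_total hM hv.1.1 hw.1.1

/-- Each of the finitely many grid lines carries at most two crossings: a third would lie between
two others, inside a shared segment, and so be discarded. -/
theorem finite_crossings (hM : M ∈ classMPlus) (ε : ℝ) : (M.crossings ε).Finite := by
  have hf : ((⋃ c ∈ gridCoords ε, {v ∈ M.crossings ε | v.1 = c}) ∪
      ⋃ c ∈ gridCoords ε, {v ∈ M.crossings ε | v.2 = c}).Finite := by
    refine ((finite_gridCoords ε).biUnion fun c hc => ?_).union
      ((finite_gridCoords ε).biUnion fun c hc => ?_)
    · refine finite_of_forall_not_lt_lt (fun a ha b hb => crossings_total hM ha.1 hb.1) ?_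
      intro u hu v hv w hw h1 h2
      refine hv.1.2 ⟨u, w, h1, h2, Or.inl (hu.2.trans hw.2.symm), fun t ht =>
        ⟨Icc_subset_boundary hM hu.1.1.1 hw.1.1.1 (Or.inl (hu.2.trans hw.2.symm)) ht, Or.inl ?_⟩⟩
      rwa [le_antisymm (ht.2.1.trans hw.2.le) (hu.2.ge.trans ht.1.1)]
    · refine finite_of_forall_not_lt_lt (fun a ha b hb => crossings_total hM ha.1 hb.1) ?_
      intro u hu v hv w hw h1 h2
      refine hv.1.2 ⟨u, w, h1, h2, Or.inr (hu.2.trans hw.2.symm), fun t ht =>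
        ⟨Icc_subset_boundary hM hu.1.1.1 hw.1.1.1 (Or.inr (hu.2.trans hw.2.symm)) ht, Or.inr ?_⟩⟩
      rwa [le_antisymm (ht.2.2.trans hw.2.le) (hu.2.ge.trans ht.1.2)]
  refine hf.subset fun v hv => ?_
  rcases hv.1.2 with h | h
  · exact Or.inl (Set.mem_biUnion h ⟨hv, rfl⟩)
  · exact Or.inr (Set.mem_biUnion h ⟨hv, rfl⟩)

/-! ### The simplified allocation region -/

theorem grid_zero_mem (ε : ℝ) : (0 : I) ∈ gridCoords ε := Or.inl rfl

theorem grid_one_mem (ε : ℝ) : (1 : I) ∈ gridCoords ε := Or.inr (Or.inl rfl)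

/-- The allocation region of the simplified mechanism, described by the intersection points that
it must not lie strictly south-east of. -/
theorem mem_pathRegion_iff (hM : M ∈ classMPlus) {ε : ℝ} {z : UnitSquare} :
    z ∈ pathRegion (M.path ε) ↔ (∃ a ∈ M.alloc, z.1 ≤ a.1) ∧ (∃ a ∈ M.alloc, a.2 ≤ z.2) ∧
      ∀ w ∈ M.crossings ε, w.1 < z.1 → w.2 ≤ z.2 := by
  constructor
  · rintro ⟨t, ht | ⟨v, v', ⟨hv, hv', hlt, hn⟩, ht⟩, h1, h2⟩
    · refine ⟨⟨t, ht.1.1.1, h1⟩, ⟨t, ht.1.1.1, h2⟩, fun w hw hl => ?_⟩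
      exact (not_lt_of_mem_boundary hM hw.1.1 ht.1.1.1 (hl.trans_le h1)).trans h2
    · have key : t.1 ≤ v'.1 ∧ v.2 ≤ t.2 := by
        rcases ht with ht | ht
        · exact ⟨ht.2.1, ht.1.2⟩
        · exact ⟨ht.2.1, ht.1.2⟩
      refine ⟨⟨v', hv'.1.1.1, h1.trans key.1⟩, ⟨v, hv.1.1.1, key.2.trans h2⟩, fun w hw hl => ?_⟩
      by_contra! hl2
      have a1 : w.1 < v'.1 := hl.trans_le (h1.trans key.1)
      have a2 : v.2 < w.2 := (key.2.trans h2).trans_lt hl2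
      -- A crossing strictly north-west of `z` would lie strictly between the consecutive points `v`
      -- and `v'`.
      refine hn ⟨w, hw, ?_, ?_⟩
      · rcases crossings_total hM hv hw with h | h
        · exact lt_of_le_of_ne h fun e => a2.ne (by rw [e])
        · exact absurd h.2 (not_le.mpr a2)
      · rcases crossings_total hM hv' hw with h | h
        · exact absurd h.1 (not_le.mpr a1)
        · exact lt_of_le_of_ne h fun e => a1.ne (by rw [e])
  · rintro ⟨⟨a, ha, haz⟩, ⟨b, hb, hbz⟩, hcr⟩
    -- The grid lines at `0` and `1` supply a crossing `u₀` no higher than `z` and a crossing `u₁`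
    -- at least as far right as `z`.
    obtain ⟨s, hs, hsB, -⟩ := exists_boundary_vertical hM
      (mem_alloc_of_dominated hM hb (v := (0, b.2)) ⟨bot_le, le_rfl⟩)
    obtain ⟨u₀, hu₀, -, -, hu₀s, -⟩ :=
      exists_crossings hM (ε := ε) ⟨hsB, Or.inl (grid_zero_mem ε)⟩
    obtain ⟨t, ht, htB, -⟩ := exists_boundary_horizontal hM
      (mem_alloc_of_dominated hM ha (v := (a.1, 1)) ⟨le_rfl, le_top⟩)
    obtain ⟨-, -, u₁, hu₁, -, htu₁, -⟩ :=
      exists_crossings hM (ε := ε) ⟨htB, Or.inr (grid_one_mem ε)⟩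
    -- `u` is the last crossing not above `z`. Either `z` dominates `u`, or `u` has a successor `u'`
    -- above `z`, and `z` dominates the corner between them.
    obtain ⟨u, ⟨hu, huz⟩, humax⟩ := ((finite_crossings hM ε).subset
      (Set.sep_subset _ fun w => w.2 ≤ z.2)).exists_maximal
      ⟨u₀, hu₀, (hu₀s.2.trans hs).trans hbz⟩
    by_cases hzu : z.1 ≤ u.1
    · exact ⟨u, Or.inl hu, hzu, huz⟩
    · push Not at hzu
      have hlast : u < u₁ := by
        have hl : u.1 < u₁.1 := hzu.trans_le (haz.trans (ht.trans htu₁.1))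
        rcases crossings_total hM hu hu₁ with h | h
        · exact lt_of_le_of_ne h fun e => hl.ne (by rw [e])
        · exact absurd h.1 (not_le.mpr hl)
      obtain ⟨u', ⟨hu', huu'⟩, hmin⟩ := ((finite_crossings hM ε).subset
        (Set.sep_subset _ fun w => u < w)).exists_minimal ⟨u₁, hu₁, hlast⟩
      have hcons : M.Consecutive ε u u' := by
        refine ⟨hu, hu', huu', ?_⟩
        rintro ⟨w, hw, h1, h2⟩
        exact absurd (hmin ⟨hw, h1⟩ h2.le) (not_le_of_gt h2)
      have hz2 : z.2 < u'.2 := by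
        by_contra! hle
        exact absurd (humax ⟨hu', hle⟩ huu'.le) (not_le_of_gt huu')
      refine ⟨(u'.1, u.2), Or.inr ⟨u, u', hcons, Or.inl ⟨⟨huu'.le.1, le_rfl⟩, le_rfl⟩⟩, ?_, huz⟩
      by_contra! hl
      exact absurd (hcr u' hu' hl) (not_le.mpr hz2)

theorem pathRegion_dominated {π : Set UnitSquare} {w v : UnitSquare} (hw : w ∈ pathRegion π)
    (h : Dominated w v) : v ∈ pathRegion π := by
  obtain ⟨t, ht, h1, h2⟩ := hw
  exact ⟨t, ht, h.1.trans h1, h2.trans h.2⟩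

theorem alloc_subset_pathRegion (hM : M ∈ classMPlus) (ε : ℝ) :
    M.alloc ⊆ pathRegion (M.path ε) := fun z hz =>
  (mem_pathRegion_iff hM).mpr
    ⟨⟨z, hz, le_rfl⟩, ⟨z, hz, le_rfl⟩, fun _ hw hl => not_lt_of_mem_boundary hM hw.1.1 hz hl⟩

/-- Discarding interior points of shared segments loses no constraint: the upper end of a vertical
segment or the left end of a horizontal one imposes a constraint at least as strong. -/
theorem le_of_mem_pathRegion (hM : M ∈ classMPlus) {ε : ℝ} {z w : UnitSquare}
    (hz : z ∈ pathRegion (M.path ε)) (hw : w ∈ M.boundary ∩ grid ε) (hl : w.1 < z.1) :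
    w.2 ≤ z.2 := by
  have h := ((mem_pathRegion_iff hM).mp hz).2.2
  obtain ⟨a, ha, b, hb, h1, h2, ⟨h3, h4⟩ | ⟨h3, h4⟩⟩ := exists_crossings hM hw
  · exact h2.2.trans (h b hb (h4.trans_lt hl))
  · exact h3.ge.trans (h a ha (h1.1.trans_lt hl))

theorem pathRegion_anti (hM : M ∈ classMPlus) {ε δ : ℝ} (h : gridCoords ε ⊆ gridCoords δ) :
    pathRegion (M.path δ) ⊆ pathRegion (M.path ε) := by
  intro z hz
  obtain ⟨h1, h2, -⟩ := (mem_pathRegion_iff hM).mp hz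
  refine (mem_pathRegion_iff hM).mpr ⟨h1, h2, fun w hw hl => ?_⟩
  exact le_of_mem_pathRegion hM hz ⟨hw.1.1, hw.1.2.imp (@h _) (@h _)⟩ hl

/-- The region is a finite union of closed quadrants, one per crossing and one per corner, since a
corner's quadrant contains that of every point of its connection. -/
theorem isClosed_pathRegion (hM : M ∈ classMPlus) (ε : ℝ) :
    IsClosed (pathRegion (M.path ε)) := by
  have e : pathRegion (M.path ε) = (⋃ a ∈ M.crossings ε, Set.Iic a.1 ×ˢ Set.Ici a.2) ∪
      ⋃ p ∈ {p ∈ M.crossings ε ×ˢ M.crossings ε | M.Consecutive ε p.1 p.2},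
        Set.Iic p.2.1 ×ˢ Set.Ici p.1.2 := by
    ext z
    simp only [pathRegion, path, Dominated, Set.mem_union, Set.mem_iUnion, Set.mem_ofPred_eq]
    constructor
    · rintro ⟨t, ht | ⟨v, v', hc, ht⟩, h1, h2⟩
      · exact Or.inl ⟨t, ht, h1, h2⟩
      · refine Or.inr ⟨(v, v'), ⟨⟨hc.1, hc.2.1⟩, hc⟩, ?_⟩
        rcases ht with ht | ht
        · exact ⟨h1.trans ht.2.1, ht.1.2.trans h2⟩
        · exact ⟨h1.trans ht.2.1, LE.le.trans ht.1.2 h2⟩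
    · rintro (⟨t, ht, h1, h2⟩ | ⟨⟨v, v'⟩, ⟨-, hc⟩, h1, h2⟩)
      · exact ⟨t, Or.inl ht, h1, h2⟩
      · exact ⟨(v'.1, v.2), Or.inr ⟨v, v', hc, Or.inl ⟨⟨hc.2.2.1.le.1, le_rfl⟩, le_rfl⟩⟩, h1, h2⟩
  rw [e]
  refine ((finite_crossings hM ε).isClosed_biUnion fun a _ => isClosed_Iic.prod isClosed_Ici).union
    (Set.Finite.isClosed_biUnion ?_ fun p _ => isClosed_Iic.prod isClosed_Ici)
  exact ((finite_crossings hM ε).prod (finite_crossings hM ε)).subset (Set.sep_subset _ _)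

/-! ### Distance to the original region -/

/-- Below every positive coordinate there is a grid coordinate at distance at most `ε`. -/
theorem exists_gridCoord_lt {ε : ℝ} (hε : 0 < ε) {x : I} (hx : 0 < x) :
    ∃ c ∈ gridCoords ε, c < x ∧ (x : ℝ) - ε ≤ c := by
  have hx' : (0 : ℝ) < x := hx
  have hx1 : (x : ℝ) ≤ 1 := x.2.2
  -- The ceiling minus one, rather than the floor, keeps `i * ε` strictly below `x` when `x` is
  -- itself a multiple of `ε`.
  obtain ⟨i, hi⟩ : ∃ i, i + 1 = ⌈(x : ℝ) / ε⌉₊ :=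
    ⟨_, Nat.succ_pred_eq_of_pos (Nat.ceil_pos.mpr (by positivity))⟩
  have h1 : (i : ℝ) < x / ε := Nat.lt_ceil.mp (by omega)
  have h2 : (x : ℝ) / ε ≤ i + 1 := by
    have := Nat.le_ceil ((x : ℝ) / ε); rw [← hi] at this; exact_mod_cast this
  rw [lt_div_iff₀ hε] at h1
  rw [div_le_iff₀ hε] at h2
  have h0 : 0 ≤ (i : ℝ) * ε := by positivity
  refine ⟨⟨i * ε, h0, by linarith⟩, ?_, h1, by simp only; linarith⟩
  rcases Nat.eq_zero_or_pos i with rfl | hp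
  · exact Or.inl (Subtype.ext (by simp))
  · exact Or.inr (Or.inr ⟨i, hp, Nat.le_floor ((le_div_iff₀ hε).mpr (by linarith)), rfl⟩)

/-- Above every coordinate less than one there is a grid coordinate at distance at most `ε`. -/
theorem exists_lt_gridCoord {ε : ℝ} (hε : 0 < ε) {y : I} (hy : y < 1) :
    ∃ c ∈ gridCoords ε, y < c ∧ (c : ℝ) ≤ y + ε := by
  have hy1 : (y : ℝ) < 1 := hy
  have hy0 : (0 : ℝ) ≤ y := y.2.1
  have h1 : (y : ℝ) / ε < ⌊(y : ℝ) / ε⌋₊ + 1 := Nat.lt_floor_add_one _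
  have h2 : (⌊(y : ℝ) / ε⌋₊ : ℝ) ≤ y / ε := Nat.floor_le (by positivity)
  rw [div_lt_iff₀ hε] at h1
  rw [le_div_iff₀ hε] at h2
  by_cases hc : ((⌊(y : ℝ) / ε⌋₊ : ℝ) + 1) * ε ≤ 1
  · refine ⟨⟨(⌊(y : ℝ) / ε⌋₊ + 1) * ε, by positivity, hc⟩, ?_, h1, by simp only; linarith⟩
    refine Or.inr (Or.inr ⟨⌊(y : ℝ) / ε⌋₊ + 1, by omega, Nat.le_floor ?_, by push_cast; rfl⟩)
    rw [le_div_iff₀ hε]; push_cast; exact hc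
  · push Not at hc
    exact ⟨1, grid_one_mem ε, hy, by simp only [Set.Icc.coe_one]; linarith⟩

/-- On a grid line `c` just left of `x`, the boundary point cannot be higher than `y`, as `(x, y)`
would be strictly south-east of it. So `(c, y)` trades in `M`. -/
theorem exists_mem_alloc_left (hM : M ∈ classMPlus) {ε : ℝ} (hε : 0 < ε) {x y : I}
    (h : (x, y) ∈ pathRegion (M.path ε)) : ∃ x', (x', y) ∈ M.alloc ∧ (x : ℝ) - ε ≤ x' := by
  obtain ⟨⟨a, ha, hxa⟩, ⟨b, hb, hby⟩, -⟩ := (mem_pathRegion_iff hM).mp h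
  rcases eq_or_lt_of_le (show (0 : I) ≤ x from bot_le) with rfl | hx
  · refine ⟨0, mem_alloc_of_dominated hM hb ⟨bot_le, hby⟩, ?_⟩
    linarith
  · obtain ⟨c, hc, hcx, hd⟩ := exists_gridCoord_lt hε hx
    obtain ⟨y', -, hB, -⟩ := exists_boundary_vertical hM
      (mem_alloc_of_dominated hM ha (v := (c, a.2)) ⟨hcx.le.trans hxa, le_rfl⟩)
    have hle : y' ≤ y := le_of_mem_pathRegion hM h ⟨hB, Or.inl hc⟩ hcx
    exact ⟨c, mem_alloc_of_dominated hM hB.1 ⟨le_rfl, hle⟩, hd⟩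

theorem exists_mem_alloc_above (hM : M ∈ classMPlus) {ε : ℝ} (hε : 0 < ε) {x y : I}
    (h : (x, y) ∈ pathRegion (M.path ε)) : ∃ y', (x, y') ∈ M.alloc ∧ (y' : ℝ) ≤ y + ε := by
  obtain ⟨⟨a, ha, hxa⟩, ⟨b, hb, hby⟩, -⟩ := (mem_pathRegion_iff hM).mp h
  rcases eq_or_lt_of_le (show y ≤ (1 : I) from le_top) with rfl | hy
  · refine ⟨1, mem_alloc_of_dominated hM ha ⟨hxa, le_top⟩, ?_⟩
    linarith
  · obtain ⟨c, hc, hcy, hd⟩ := exists_lt_gridCoord hε hy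
    obtain ⟨x', -, hB, -⟩ := exists_boundary_horizontal hM
      (mem_alloc_of_dominated hM hb (v := (b.1, c)) ⟨le_rfl, hby.trans hcy.le⟩)
    have hle : x ≤ x' := by
      by_contra! hl
      exact absurd (le_of_mem_pathRegion hM h ⟨hB, Or.inr hc⟩ hl) (not_le.mpr hcy)
    exact ⟨c, mem_alloc_of_dominated hM hB.1 ⟨hle, le_rfl⟩, hd⟩

theorem gridCoords_two_zpow_subset (h : ℕ) :
    gridCoords ((2 : ℝ) ^ (-(h : ℤ))) ⊆ gridCoords ((2 : ℝ) ^ (-((h + 1 : ℕ) : ℤ))) := by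
  have e : (2 : ℝ) ^ (-(h : ℤ)) = 2 * (2 : ℝ) ^ (-((h + 1 : ℕ) : ℤ)) := by
    rw [← zpow_one_add₀ two_ne_zero]; congr 1; push_cast; ring
  have hp : (0 : ℝ) < (2 : ℝ) ^ (-((h + 1 : ℕ) : ℤ)) := by positivity
  rintro x (hx | hx | ⟨i, hi, -, hx⟩)
  · exact Or.inl hx
  · exact Or.inr (Or.inl hx)
  · have hx2 : (x : ℝ) = (2 * i : ℕ) * (2 : ℝ) ^ (-((h + 1 : ℕ) : ℤ)) := by
      rw [hx, e]; push_cast; ring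
    refine Or.inr (Or.inr ⟨2 * i, by omega, Nat.le_floor ?_, hx2⟩)
    rw [le_div_iff₀ hp, ← hx2]
    exact x.2.2

/-! ### Measurability and comparison of profits -/

/-- On `A` each price is a monotone function of the other agent's bid alone. -/
theorem measurable_profit_myerson {A : Set UnitSquare} (hA : IsClosed A)
    (hd : ∀ w ∈ A, ∀ v, Dominated w v → v ∈ A) : Measurable (myerson A).profit := by
  have h1 : Measurable fun y : I => sSup {x : I | (x, y) ∈ A} :=
    Monotone.measurable fun y y' hy => sSup_le_sSup fun x hx => hd _ hx _ ⟨le_rfl, hy⟩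
  have h2 : Measurable fun x : I => sInf {y : I | (x, y) ∈ A} :=
    Monotone.measurable fun x x' hx => sInf_le_sInf fun y hy => hd _ hy _ ⟨hx, le_rfl⟩
  have h3 : Measurable (myerson A).sellerPay :=
    (h1.comp measurable_snd).indicator hA.measurableSet
  have h4 : Measurable (myerson A).buyerPay :=
    (h2.comp measurable_fst).indicator hA.measurableSet
  exact (measurable_subtype_coe.comp h4).sub (measurable_subtype_coe.comp h3)

theorem abs_profit_le_one (M : Mechanism) (v : UnitSquare) : |M.profit v| ≤ 1 := by
  have h1 := (M.buyerPay v).2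
  have h2 := (M.sellerPay v).2
  rw [profit, abs_le]
  constructor <;> linarith [h1.1, h1.2, h2.1, h2.2]

theorem profit_eq_zero {M : Mechanism} {v : UnitSquare} (h : v ∉ M.alloc) : M.profit v = 0 := by
  simp [profit, M.buyerPay_eq_zero v h, M.sellerPay_eq_zero v h]

/-- Refining the grid raises the profit at each point by at most twice the precision. -/
theorem profit_simplified_le (hM : M ∈ classMPlus) {ε δ : ℝ} (hε : 0 < ε)
    (h : gridCoords ε ⊆ gridCoords δ) (v : UnitSquare) :
    (M.simplified δ).profit v ≤ (M.simplified ε).profit v + 2 * ε := by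
  set A := pathRegion (M.path ε) with hA
  set A' := pathRegion (M.path δ)
  have hsub : A' ⊆ A := pathRegion_anti hM h
  by_cases hv : v ∈ A
  swap
  · rw [profit_eq_zero (M := M.simplified ε) hv,
      profit_eq_zero (M := M.simplified δ) fun hv' => hv (hsub hv')]
    linarith
  have hp := myerson_sellerPay_isGreatest (isClosed_pathRegion hM ε) hv
  have hq := myerson_buyerPay_isLeast (isClosed_pathRegion hM ε) hv
  obtain ⟨x, hx, hxp⟩ := exists_mem_alloc_left hM hε hp.1
  obtain ⟨y, hy, hyq⟩ := exists_mem_alloc_above hM hε hq.1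
  rw [← hA] at hxp hyq
  change _ ≤ (((myerson A).buyerPay v : ℝ) - ((myerson A).sellerPay v : ℝ)) + 2 * ε
  by_cases hv' : v ∈ A'
  · have hp' := myerson_sellerPay_isGreatest (isClosed_pathRegion hM δ) hv'
    have hq' := myerson_buyerPay_isLeast (isClosed_pathRegion hM δ) hv'
    have a1 : (x : ℝ) ≤ (myerson A').sellerPay v := hp'.2 (alloc_subset_pathRegion hM δ hx)
    have a2 : ((myerson A').buyerPay v : ℝ) ≤ y := hq'.2 (alloc_subset_pathRegion hM δ hy)
    change ((myerson A').buyerPay v : ℝ) - ((myerson A').sellerPay v : ℝ) ≤ _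
    linarith
  · rw [profit_eq_zero (M := M.simplified δ) hv']
    -- Trade is lost, so the coarse profit must be at least `-2 * ε`. The height `v.2` separates `x`
    -- from `y`: `(x, v.2)` lies in the triangle, while `v` does not trade in `M`.
    have a1 : (x : ℝ) ≤ v.2 := le_of_mem_alloc hM hx
    have a2 : (v.2 : ℝ) ≤ y := by
      by_contra! hl
      have hl' : y ≤ v.2 := le_of_lt hl
      exact hv' (alloc_subset_pathRegion hM δ (mem_alloc_of_dominated hM hy ⟨le_rfl, hl'⟩))
    linarith

end Mechanism

/-! ### The dichotomy -/

theorem mainTheorem10 (M : Mechanism) (hM : M ∈ Mechanism.classMPlus) (h : ℕ)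
    (D : Measure UnitSquare) [IsProbabilityMeasure D] :
    Integrable (fun v => (M.approx h).profit v) D ∧
    Integrable (fun v => (M.approx (h + 1)).profit v) D ∧
    Integrable (fun v => ((M.approx (h + 1)).profit v - (M.approx h).profit v) ^ 2) D ∧
    (31 * (2 : ℝ) ^ (-(h : ℤ)) ≤
        ∫ v, ((M.approx h).profit v - (M.approx (h + 1)).profit v) ∂D ∨
      ∫ v, ((M.approx (h + 1)).profit v - (M.approx h).profit v) ^ 2 ∂D ≤
        136 * (2 : ℝ) ^ (-(h : ℤ))) := by
  have hmeas (k : ℕ) : Measurable (M.approx k).profit :=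
    Mechanism.measurable_profit_myerson (Mechanism.isClosed_pathRegion hM _)
      fun w hw v hv => Mechanism.pathRegion_dominated hw hv
  have hint (k : ℕ) : Integrable (fun v => (M.approx k).profit v) D :=
    Integrable.of_bound (hmeas k).aestronglyMeasurable 1
      (Filter.Eventually.of_forall fun v => Mechanism.abs_profit_le_one _ v)
  have hbd (v : UnitSquare) : |(M.approx (h + 1)).profit v - (M.approx h).profit v| ≤ 2 :=
    (abs_sub _ _).trans (by
      linarith [(M.approx (h + 1)).abs_profit_le_one v, (M.approx h).abs_profit_le_one v])
  have hsq : Integrable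
      (fun v => ((M.approx (h + 1)).profit v - (M.approx h).profit v) ^ 2) D := by
    refine Integrable.of_bound
      (((hmeas (h + 1)).sub (hmeas h)).pow_const 2).aestronglyMeasurable (2 ^ 2)
      (Filter.Eventually.of_forall fun v => ?_)
    rw [norm_pow]
    exact pow_le_pow_left₀ (norm_nonneg _) (hbd v) 2
  refine ⟨hint h, hint (h + 1), hsq, or_iff_not_imp_left.mpr fun hlt => ?_⟩
  push Not at hlt
  set ε : ℝ := (2 : ℝ) ^ (-(h : ℤ))
  have hpos : 0 < ε := by positivity
  have hdiff : Integrable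
      (fun v => (M.approx h).profit v - (M.approx (h + 1)).profit v) D := (hint h).sub (hint (h + 1))
  calc ∫ v, ((M.approx (h + 1)).profit v - (M.approx h).profit v) ^ 2 ∂D
      ≤ ∫ v, (2 * ((M.approx h).profit v - (M.approx (h + 1)).profit v) + 8 * ε) ∂D := by
        refine integral_mono hsq ((hdiff.const_mul 2).add (integrable_const _)) fun v => ?_
        have h1 : (M.approx (h + 1)).profit v ≤ (M.approx h).profit v + 2 * ε :=
          Mechanism.profit_simplified_le hM hpos (Mechanism.gridCoords_two_zpow_subset h) v
        have h2 := abs_le.mp (hbd v)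
        simp only
        -- With `X` the coarse minus the fine profit, expand `(X + 2ε)(2 - X) ≥ 0` and use `X ≥ -2`
        -- in the term `-2εX`.
        nlinarith [h2.1, h2.2]
    _ = 2 * ∫ v, ((M.approx h).profit v - (M.approx (h + 1)).profit v) ∂D + 8 * ε := by
        rw [integral_add (hdiff.const_mul 2) (integrable_const _), integral_const_mul]
        simp
    _ ≤ 136 * ε := by linarith
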